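/- For real $L$ and $\kappa>0$, call a unit vector $v\in\mathbb{S}^{N-1}\subset\mathbb{R}^N$ $(L,\kappa)$-delocalized if $\sum_{j\in A}v_j^2\le\kappa^2$ for every set $A\subseteq\{1,\dots,N\}$ with $|A|\le L$, and let $D_{L,\kappa}\subseteq\mathbb{S}^{N-1}$ be the set of all such vectors. For each $N\ge 1$ let $V_N$ be a random vector uniformly distributed on $\mathbb{S}^{N-1}$. There exist universal constants $c_1,c_2>0$ such that for every $0<\kappa<1$ independent of $N$ and every sequence of real numbers $(\nu_N)$ (in particular every constant sequence $\nu_N=\nu$), the following hold as $N\to\infty$. a. If $\nu_N\le\dfrac{c_1\kappa^2}{\log(e/\kappa)}$ for all $N$, then $\mathbf{P}[V_N\in D_{\nu_N N,\kappa}]=1-o(1)$. b. If $\nu_N\ge\dfrac{c_2\kappa^2}{\log(e/\kappa)}$ for all $N$, then $\mathbf{P}[V_N\in D_{\nu_N N,\kappa}]=o(1)$. -/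

import Mathlib

open MeasureTheory ProbabilityTheory Filter Topology

/-- The set `D_{L,κ}` of `(L,κ)`-delocalized unit vectors of `ℝ^N`: for every set `A` of at most
`L` coordinates, `∑_{j ∈ A} v_j² ≤ κ²`. Here `L` is a real number. -/
def delocalizedSet (N : ℕ) (L κ : ℝ) : Set (EuclideanSpace ℝ (Fin N)) :=
  {v | v ∈ Metric.sphere (0 : EuclideanSpace ℝ (Fin N)) 1 ∧
    ∀ A : Finset (Fin N), (A.card : ℝ) ≤ L → ∑ j ∈ A, |v j| ^ 2 ≤ κ ^ 2}

/-- The uniform distribution on the unit sphere of `ℝ^N` (`N ≥ 1`), as a measure on `ℝ^N`: the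
surface measure of the sphere, normalized to have total mass one. -/
noncomputable def uniformSphere (N : ℕ) : Measure (EuclideanSpace ℝ (Fin N)) :=
  let σ := (volume : Measure (EuclideanSpace ℝ (Fin N))).toSphere
  ((σ Set.univ)⁻¹ • σ).map Subtype.val

/-! A uniform point of the sphere is the direction of a standard Gaussian vector, so all dimensions
can be realized on one space, using the first `N` terms of a single i.i.d. Gaussian sequence
(`map_gaussianDirection`). There the strong law gives, almost surely, `∑ ω i ^ 2 ~ N` and `∑ tailSq
t (ω i) ~ F N`, where `F` is the Gaussian second moment beyond the level `x ^ 2 = t`. The mass of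
the largest `ν N` squares is then controlled by one threshold `t` of order `log (e / κ)`. It is at
most about `(F + ν t) N`, and it exceeds about `min F (ν t) * N`. Since `F` decays exponentially in
`t`, a suitable multiple of `log (e / κ)` puts `F` below or above `κ ^ 2`, and comparing `ν t` with
`κ ^ 2` gives the two regimes. -/

/-! ### The uniform law on the sphere as the direction of a Gaussian vector. -/

/-- Polar decomposition of a measure with radial density: the set of points whose direction lies
in `S` has measure proportional to `μ.toSphere S`. -/
theorem withDensity_norm_apply_direction_preimage {E : Type*} [NormedAddCommGroup E]
    [NormedSpace ℝ E] [MeasurableSpace E] [BorelSpace E] [FiniteDimensional ℝ E] [Nontrivial E]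
    (μ : Measure E) [μ.IsAddHaarMeasure] {f : ℝ → ENNReal} (hf : Measurable f)
    {S : Set E} (hS : MeasurableSet S) :
    μ.withDensity (fun x => f ‖x‖) ((fun x => ‖x‖⁻¹ • x) ⁻¹' S) =
      μ.toSphere (Subtype.val ⁻¹' S) *
        ∫⁻ r, f r.1 ∂(Measure.volumeIoiPow (Module.finrank ℝ E - 1)) := by
  have hdir : Measurable (fun x : E => ‖x‖⁻¹ • x) := by fun_prop
  set g : E → ENNReal := ((fun x : E => ‖x‖⁻¹ • x) ⁻¹' S).indicator (fun x => f ‖x‖) with hg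
  have hSs : MeasurableSet ((Subtype.val : Metric.sphere (0 : E) 1 → E) ⁻¹' S) :=
    measurable_subtype_coe hS
  calc
    _ = ∫⁻ x, g x ∂μ := by
      rw [withDensity_apply _ (hdir hS), lintegral_indicator (hdir hS)]
    _ = ∫⁻ x : ({0}ᶜ : Set E), g x.1 ∂(μ.comap (↑)) := by
      rw [lintegral_subtype_comap (measurableSet_singleton _).compl, restrict_compl_singleton]
    _ = ∫⁻ p, (Subtype.val ⁻¹' S).indicator (fun _ => 1) p.1 * f p.2.1
          ∂(μ.toSphere.prod (Measure.volumeIoiPow (Module.finrank ℝ E - 1))) := by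
      rw [← μ.measurePreserving_homeomorphUnitSphereProd.lintegral_comp_emb
        (Homeomorph.measurableEmbedding _)]
      refine lintegral_congr fun x => ?_
      by_cases h : ‖x.1‖⁻¹ • x.1 ∈ S
      · simp [hg, Set.indicator, h]
      · simp [hg, Set.indicator, h]
    _ = _ := by
      rw [lintegral_prod_mul
        (f := (Subtype.val ⁻¹' S : Set (Metric.sphere (0 : E) 1)).indicator fun _ => 1)
        (g := fun r : Set.Ioi (0 : ℝ) => f r.1) (measurable_const.indicator hSs).aemeasurable
        (hf.comp measurable_subtype_coe).aemeasurable]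
      congr 1
      exact lintegral_indicator_one hSs

/-- The direction of a random vector with radial density is uniformly distributed. -/
theorem map_direction_withDensity_norm {E : Type*} [NormedAddCommGroup E]
    [NormedSpace ℝ E] [MeasurableSpace E] [BorelSpace E] [FiniteDimensional ℝ E] [Nontrivial E]
    (μ : Measure E) [μ.IsAddHaarMeasure] {f : ℝ → ENNReal} (hf : Measurable f)
    [IsProbabilityMeasure (μ.withDensity (fun x => f ‖x‖))] :
    (μ.withDensity (fun x => f ‖x‖)).map (fun x => ‖x‖⁻¹ • x) =
      ((μ.toSphere Set.univ)⁻¹ • μ.toSphere).map Subtype.val := by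
  ext S hS
  rw [Measure.map_apply (by fun_prop) hS, Measure.map_apply measurable_subtype_coe hS,
    withDensity_norm_apply_direction_preimage μ hf hS, Measure.smul_apply, smul_eq_mul, mul_comm]
  congr 1
  -- Total mass one forces the radial integral to be the normalizing constant, so it need not be
  -- computed.
  have h := withDensity_norm_apply_direction_preimage μ hf MeasurableSet.univ
  rw [Set.preimage_univ, Set.preimage_univ, measure_univ, mul_comm] at h
  exact ENNReal.eq_inv_of_mul_eq_one_left h.symm

theorem pi_gaussianReal_eq_withDensity (ι : Type*) [Fintype ι] :
    Measure.pi (fun _ : ι => gaussianReal 0 1) =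
      volume.withDensity (fun x : ι → ℝ => ENNReal.ofReal (∏ i, gaussianPDFReal 0 1 (x i))) := by
  refine Measure.pi_eq fun s hs => ?_
  have hint : ∀ i, Integrable ((s i).indicator (gaussianPDFReal 0 1)) := fun i =>
    (integrable_gaussianPDFReal 0 1).indicator (hs i)
  have hnn : ∀ i x, 0 ≤ (s i).indicator (gaussianPDFReal 0 1) x := fun i x =>
    Set.indicator_nonneg (fun y _ => gaussianPDFReal_nonneg 0 1 y) x
  calc
    _ = ∫⁻ x : ι → ℝ, ENNReal.ofReal (∏ i, (s i).indicator (gaussianPDFReal 0 1) (x i)) := by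
      rw [withDensity_apply _ (MeasurableSet.univ_pi hs),
        ← lintegral_indicator (MeasurableSet.univ_pi hs)]
      refine lintegral_congr fun x => ?_
      by_cases h : x ∈ Set.univ.pi s
      · rw [Set.indicator_of_mem h]
        congr 1
        exact Finset.prod_congr rfl fun i _ => (Set.indicator_of_mem (h i trivial) _).symm
      · rw [Set.indicator_of_notMem h]
        simp only [Set.mem_pi, not_forall] at h
        obtain ⟨i, -, hi⟩ := h
        rw [Finset.prod_eq_zero (Finset.mem_univ i) (Set.indicator_of_notMem hi _)]
        simp
    _ = ENNReal.ofReal (∏ i, ∫ x, (s i).indicator (gaussianPDFReal 0 1) x) := by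
      rw [← integral_fintype_prod_volume_eq_prod]
      exact (ofReal_integral_eq_lintegral_ofReal (Integrable.fintype_prod hint)
        (Eventually.of_forall fun x => Finset.prod_nonneg fun i _ => hnn i _)).symm
    _ = _ := by
      rw [ENNReal.ofReal_prod_of_nonneg fun i _ => integral_nonneg (hnn i)]
      refine Finset.prod_congr rfl fun i _ => ?_
      rw [gaussianReal_apply_eq_integral 0 one_ne_zero, integral_indicator (hs i)]

/-- The direction of a standard Gaussian vector is uniformly distributed on the sphere. -/
theorem uniformSphere_eq_map_gaussian {N : ℕ} (hN : 1 ≤ N) :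
    uniformSphere N = (Measure.pi (fun _ : Fin N => gaussianReal 0 1)).map
      (fun x => ‖WithLp.toLp 2 x‖⁻¹ • WithLp.toLp 2 x) := by
  have : Nonempty (Fin N) := ⟨⟨0, hN⟩⟩
  set f : ℝ → ENNReal := fun r =>
    ENNReal.ofReal ((√(2 * Real.pi))⁻¹ ^ N * Real.exp (-(r ^ 2) / 2)) with hf
  have hfm : Measurable f := by fun_prop
  have key : (Measure.pi (fun _ : Fin N => gaussianReal 0 1)).map (WithLp.toLp 2) =
      (volume : Measure (EuclideanSpace ℝ (Fin N))).withDensity (fun x => f ‖x‖) := by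
    have hdens : (fun x : Fin N → ℝ => ENNReal.ofReal (∏ i, gaussianPDFReal 0 1 (x i))) =
        fun x => f ‖(WithLp.toLp 2 x : EuclideanSpace ℝ (Fin N))‖ := by
      funext x
      simp only [hf, gaussianPDFReal, Finset.prod_mul_distrib, ← Real.exp_sum,
        EuclideanSpace.norm_sq_eq]
      simp [Finset.sum_div, Finset.sum_neg_distrib, neg_div]
    rw [pi_gaussianReal_eq_withDensity, hdens]
    ext s hs
    have hmp := PiLp.volume_preserving_toLp (Fin N)
    rw [Measure.map_apply hmp.measurable hs, withDensity_apply _ hs,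
      withDensity_apply _ (hmp.measurable hs),
      hmp.setLIntegral_comp_preimage hs (f := fun x => f ‖x‖) (by fun_prop)]
  have : IsProbabilityMeasure
      ((volume : Measure (EuclideanSpace ℝ (Fin N))).withDensity (fun x => f ‖x‖)) := by
    rw [← key]
    exact Measure.isProbabilityMeasure_map (by fun_prop)
  rw [uniformSphere, ← map_direction_withDensity_norm volume hfm, ← key,
    Measure.map_map (by fun_prop) (by fun_prop)]
  rfl

/-- For i.i.d. standard Gaussians `ω 0, ω 1, …`, the normalized vector of the first `N`. -/
noncomputable def gaussianDirection (N : ℕ) (ω : ℕ → ℝ) : EuclideanSpace ℝ (Fin N) :=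
  ‖WithLp.toLp 2 (fun i : Fin N => ω i)‖⁻¹ • WithLp.toLp 2 (fun i : Fin N => ω i)

theorem measurable_gaussianDirection (N : ℕ) : Measurable (gaussianDirection N) := by
  unfold gaussianDirection
  fun_prop

theorem map_gaussianDirection {N : ℕ} (hN : 1 ≤ N) :
    (Measure.infinitePi (fun _ : ℕ => gaussianReal 0 1)).map (gaussianDirection N) =
      uniformSphere N := by
  have h := Measure.map_infinitePi_infinitePi_of_inj (P := fun _ : ℕ => gaussianReal 0 1)
    (Fin.val_injective (n := N))
  rw [uniformSphere_eq_map_gaussian hN, ← Measure.infinitePi_eq_pi, ← h,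
    Measure.map_map (by fun_prop) (by fun_prop)]
  rfl

theorem measurableSet_delocalizedSet (N : ℕ) (L κ : ℝ) :
    MeasurableSet (delocalizedSet N L κ) := by
  have h : delocalizedSet N L κ = Metric.sphere 0 1 ∩
      ⋂ A : Finset (Fin N), ⋂ _ : (A.card : ℝ) ≤ L,
        {v : EuclideanSpace ℝ (Fin N) | ∑ j ∈ A, |v j| ^ 2 ≤ κ ^ 2} := by
    ext v; simp [delocalizedSet]
  rw [h]
  refine Metric.isClosed_sphere.measurableSet.inter
    (MeasurableSet.iInter fun A => MeasurableSet.iInter fun _ => ?_)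
  exact measurableSet_le (by fun_prop) measurable_const

/-! ### Strong law and truncated Gaussian second moments. -/

/-- Law of large numbers for coordinates of the infinite Gaussian product. -/
theorem ae_tendsto_average_gaussian {f : ℝ → ℝ} (hf : Measurable f)
    (hint : Integrable f (gaussianReal 0 1)) :
    ∀ᵐ ω ∂(Measure.infinitePi (fun _ : ℕ => gaussianReal 0 1)),
      Tendsto (fun n : ℕ => (∑ i ∈ Finset.range n, f (ω i)) / n) atTop
        (𝓝 (∫ x, f x ∂(gaussianReal 0 1))) := by
  set μ := Measure.infinitePi (fun _ : ℕ => gaussianReal 0 1)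
  have hmp : ∀ i : ℕ, MeasurePreserving (Function.eval i) μ (gaussianReal 0 1) := fun i =>
    measurePreserving_eval_infinitePi (fun _ : ℕ => gaussianReal 0 1) i
  have hind : iIndepFun (fun i (ω : ℕ → ℝ) => f (ω i)) μ :=
    iIndepFun_infinitePi (X := fun _ => f) fun _ => hf
  have h := strong_law_ae_real (μ := μ) (fun i (ω : ℕ → ℝ) => f (ω i))
    ((hmp 0).integrable_comp_of_integrable hint)
    (fun i j hij => hind.indepFun hij)
    (fun i => ⟨(hf.comp (measurable_pi_apply i)).aemeasurable,
      (hf.comp (measurable_pi_apply 0)).aemeasurable, by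
        change μ.map (f ∘ Function.eval i) = μ.map (f ∘ Function.eval 0)
        rw [← Measure.map_map hf (measurable_pi_apply i),
          ← Measure.map_map hf (measurable_pi_apply 0), (hmp i).map_eq, (hmp 0).map_eq]⟩)
  have hI : μ[fun ω : ℕ → ℝ => f (ω 0)] = ∫ x, f x ∂(gaussianReal 0 1) := by
    rw [← (hmp 0).map_eq, integral_map (hmp 0).measurable.aemeasurable
      hf.aestronglyMeasurable]
  rw [hI] at h
  exact h

theorem integrable_sq_gaussian : Integrable (fun x : ℝ => x ^ 2) (gaussianReal 0 1) := by
  simpa using (memLp_id_gaussianReal (μ := 0) (v := 1) 2).integrable_sq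

theorem integral_sq_gaussian : ∫ x, x ^ 2 ∂(gaussianReal 0 1) = 1 := by
  have h := variance_fun_id_gaussianReal (μ := 0) (v := 1)
  rw [variance_eq_integral (by fun_prop)] at h
  simpa using h

/-- The square, truncated to the values exceeding `t`. -/
noncomputable def tailSq (t x : ℝ) : ℝ := if t < x ^ 2 then x ^ 2 else 0

theorem tailSq_nonneg (t x : ℝ) : 0 ≤ tailSq t x := by
  unfold tailSq; split_ifs <;> positivity

theorem tailSq_le_sq (t x : ℝ) : tailSq t x ≤ x ^ 2 := by
  unfold tailSq; split_ifs
  · rfl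
  · positivity

theorem sq_le_add_tailSq {t : ℝ} (ht : 0 ≤ t) (x : ℝ) : x ^ 2 ≤ t + tailSq t x := by
  unfold tailSq; split_ifs <;> linarith

theorem measurable_tailSq (t : ℝ) : Measurable (tailSq t) :=
  Measurable.ite (measurableSet_lt measurable_const (by fun_prop)) (by fun_prop) measurable_const

theorem integrable_tailSq_gaussian (t : ℝ) : Integrable (tailSq t) (gaussianReal 0 1) :=
  integrable_sq_gaussian.mono' (measurable_tailSq t).aestronglyMeasurable
    (Eventually.of_forall fun x => by
      rw [Real.norm_of_nonneg (tailSq_nonneg t x)]; exact tailSq_le_sq t x)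

/-- Chernoff-type bound: `y ≤ exp y` at `y = x ^ 2 / 8`, and `x ^ 2 / 8 ≤ x ^ 2 / 4 - t / 8` beyond
the threshold. The exponent `1 / 4` stays integrable against the Gaussian density. -/
theorem tailSq_le_exp (t x : ℝ) :
    tailSq t x ≤ 8 * Real.exp (-t / 8) * Real.exp (x ^ 2 / 4) := by
  unfold tailSq
  split_ifs with h
  · have h1 : x ^ 2 / 8 ≤ Real.exp (x ^ 2 / 8) := by linarith [Real.add_one_le_exp (x ^ 2 / 8)]
    have h2 : Real.exp (x ^ 2 / 8) ≤ Real.exp (-t / 8) * Real.exp (x ^ 2 / 4) := by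
      rw [← Real.exp_add]; exact Real.exp_le_exp.2 (by linarith)
    linarith
  · positivity

theorem integral_tailSq_gaussian_le (t : ℝ) :
    ∫ x, tailSq t x ∂(gaussianReal 0 1) ≤ 16 * Real.exp (-t / 8) := by
  rw [integral_gaussianReal_eq_integral_smul one_ne_zero]
  set c : ℝ := (√(2 * Real.pi))⁻¹ * (8 * Real.exp (-t / 8)) with hc
  have hle : ∀ x, gaussianPDFReal 0 1 x • tailSq t x ≤ c * Real.exp (-(1 / 4) * x ^ 2) := by
    intro x
    calc gaussianPDFReal 0 1 x • tailSq t x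
        ≤ gaussianPDFReal 0 1 x * (8 * Real.exp (-t / 8) * Real.exp (x ^ 2 / 4)) :=
          mul_le_mul_of_nonneg_left (tailSq_le_exp t x) (gaussianPDFReal_nonneg 0 1 x)
      _ = c * (Real.exp (-(x ^ 2) / 2) * Real.exp (x ^ 2 / 4)) := by
          simp only [gaussianPDFReal, hc]; simp; ring
      _ = _ := by rw [← Real.exp_add]; ring_nf
  calc ∫ x, gaussianPDFReal 0 1 x • tailSq t x
      ≤ ∫ x, c * Real.exp (-(1 / 4) * x ^ 2) :=
        integral_mono_of_nonneg
          (Eventually.of_forall fun x =>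
            mul_nonneg (gaussianPDFReal_nonneg 0 1 x) (tailSq_nonneg t x))
          ((integrable_exp_neg_mul_sq (by norm_num)).const_mul c) (Eventually.of_forall hle)
    _ = 8 * Real.exp (-t / 8) * ((√(2 * Real.pi))⁻¹ * √(Real.pi / (1 / 4))) := by
        rw [integral_const_mul, integral_gaussian]; ring
    _ ≤ 8 * Real.exp (-t / 8) * 2 := by
        gcongr
        rw [inv_mul_le_iff₀ (by positivity)]
        refine Real.sqrt_le_iff.2 ⟨by positivity, ?_⟩
        rw [mul_pow, Real.sq_sqrt (by positivity)]
        linarith [Real.pi_pos]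
    _ = _ := by ring

/-- Only the unit interval just above `√t` is kept; there the square exceeds `t` and the density is
bounded below. -/
theorem le_integral_tailSq_gaussian {t : ℝ} (ht : 0 ≤ t) :
    t * (Real.exp (-(t + 1)) / 3) ≤ ∫ x, tailSq t x ∂(gaussianReal 0 1) := by
  set I := Set.Ioo (√t) (√t + 1) with hI
  have hpdf : ∀ x ∈ I, Real.exp (-(t + 1)) / 3 ≤ gaussianPDFReal 0 1 x := by
    rintro x ⟨h1, h2⟩
    have hs := Real.sqrt_nonneg t
    have hx : x ^ 2 ≤ 2 * t + 2 := by
      nlinarith [Real.sq_sqrt ht, sq_nonneg (√t - 1)]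
    have h3 : √(2 * Real.pi) ≤ 3 :=
      Real.sqrt_le_iff.2 ⟨by norm_num, by linarith [Real.pi_lt_d2]⟩
    have h4 : (1 / 3 : ℝ) ≤ (√(2 * Real.pi))⁻¹ := by
      rw [one_div]; exact inv_anti₀ (by positivity) h3
    have h5 : Real.exp (-(t + 1)) ≤ Real.exp (-(x ^ 2) / 2) :=
      Real.exp_le_exp.2 (by linarith)
    calc Real.exp (-(t + 1)) / 3 = 1 / 3 * Real.exp (-(t + 1)) := by ring
      _ ≤ (√(2 * Real.pi))⁻¹ * Real.exp (-(x ^ 2) / 2) := by gcongr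
      _ = gaussianPDFReal 0 1 x := by simp [gaussianPDFReal]
  have hmeas : Real.exp (-(t + 1)) / 3 ≤ (gaussianReal 0 1).real I := by
    have h := setIntegral_ge_of_const_le_real (μ := volume) measurableSet_Ioo (by simp) hpdf
      (integrable_gaussianPDFReal 0 1).integrableOn
    rw [measureReal_def, gaussianReal_apply_eq_integral 0 one_ne_zero,
      ENNReal.toReal_ofReal (integral_nonneg fun x => gaussianPDFReal_nonneg 0 1 x)]
    simpa [hI] using h
  calc t * (Real.exp (-(t + 1)) / 3) ≤ t * (gaussianReal 0 1).real I := by gcongr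
    _ ≤ ∫ x in I, tailSq t x ∂(gaussianReal 0 1) := by
        refine setIntegral_ge_of_const_le_real measurableSet_Ioo (measure_ne_top _ _) ?_
          (integrable_tailSq_gaussian t).integrableOn
        rintro x ⟨h1, -⟩
        have : t < x ^ 2 := Real.lt_sq_of_sqrt_lt h1
        simp [tailSq, this, this.le]
    _ ≤ _ := setIntegral_le_integral (integrable_tailSq_gaussian t)
        (Eventually.of_forall fun x => tailSq_nonneg t x)

/-! ### Deterministic criteria for a sequence obeying the two averages. -/

theorem gaussianDirection_mem_delocalizedSet_iff {N : ℕ} {ω : ℕ → ℝ} {L κ : ℝ}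
    (hpos : 0 < ∑ i ∈ Finset.range N, ω i ^ 2) :
    gaussianDirection N ω ∈ delocalizedSet N L κ ↔
      ∀ A : Finset (Fin N), (A.card : ℝ) ≤ L →
        ∑ j ∈ A, ω j ^ 2 ≤ κ ^ 2 * ∑ i ∈ Finset.range N, ω i ^ 2 := by
  set x : EuclideanSpace ℝ (Fin N) := WithLp.toLp 2 (fun i : Fin N => ω i) with hx
  have hn : ‖x‖ ^ 2 = ∑ i ∈ Finset.range N, ω i ^ 2 := by
    rw [EuclideanSpace.norm_sq_eq, Finset.sum_range]
    simp [hx]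
  have hx0 : x ≠ 0 := by
    rintro h
    rw [h] at hn
    simp at hn
    simp [← hn] at hpos
  have hcoord : ∀ A : Finset (Fin N), ∑ j ∈ A, |gaussianDirection N ω j| ^ 2 =
      (∑ j ∈ A, ω j ^ 2) / ∑ i ∈ Finset.range N, ω i ^ 2 := by
    intro A
    rw [Finset.sum_div, ← hn]
    refine Finset.sum_congr rfl fun j _ => ?_
    change |‖x‖⁻¹ * ω j| ^ 2 = _
    rw [sq_abs, mul_pow, inv_pow, div_eq_inv_mul]
  have hmem : gaussianDirection N ω ∈ Metric.sphere (0 : EuclideanSpace ℝ (Fin N)) 1 := by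
    change ‖x‖⁻¹ • x ∈ _
    simp [norm_smul, hx0]
  simp only [delocalizedSet, Set.mem_ofPred_eq, hmem, true_and, hcoord, div_le_iff₀ hpos]

theorem eventually_sum_pos {ω : ℕ → ℝ}
    (hS : Tendsto (fun n : ℕ => (∑ i ∈ Finset.range n, ω i ^ 2) / n) atTop (𝓝 1)) :
    ∀ᶠ n : ℕ in atTop, 0 < ∑ i ∈ Finset.range n, ω i ^ 2 := by
  filter_upwards [hS.eventually (lt_mem_nhds zero_lt_one), eventually_gt_atTop 0] with n h hn
  exact (div_pos_iff_of_pos_right (by exact_mod_cast hn)).1 h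

theorem eventually_gaussianDirection_mem {ω : ℕ → ℝ} {t ν₀ κ F : ℝ} (ht : 0 ≤ t)
    (hS : Tendsto (fun n : ℕ => (∑ i ∈ Finset.range n, ω i ^ 2) / n) atTop (𝓝 1))
    (hT : Tendsto (fun n : ℕ => (∑ i ∈ Finset.range n, tailSq t (ω i)) / n) atTop (𝓝 F))
    (hF : F + ν₀ * t < κ ^ 2) {ν : ℕ → ℝ} (hν : ∀ N, ν N ≤ ν₀) :
    ∀ᶠ N : ℕ in atTop, gaussianDirection N ω ∈ delocalizedSet N (ν N * N) κ := by
  have hlim := (hT.add_const (ν₀ * t)).eventually_lt (hS.const_mul (κ ^ 2)) (by simpa using hF)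
  filter_upwards [hlim, eventually_gt_atTop 0, eventually_sum_pos hS] with N h hN hpos
  have hN' : (0 : ℝ) < N := by exact_mod_cast hN
  rw [gaussianDirection_mem_delocalizedSet_iff hpos]
  intro A hA
  have hA' : (A.card : ℝ) ≤ ν₀ * N := hA.trans (by gcongr; exact hν N)
  rw [← mul_div_assoc, ← sub_pos, ← mul_pos_iff_of_pos_right hN'] at h
  field_simp at h
  calc ∑ j ∈ A, ω j ^ 2 ≤ ∑ j ∈ A, (t + tailSq t (ω j)) :=
        Finset.sum_le_sum fun j _ => sq_le_add_tailSq ht _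
    _ = A.card * t + ∑ j ∈ A, tailSq t (ω j) := by simp [Finset.sum_add_distrib]
    _ ≤ ν₀ * N * t + ∑ j : Fin N, tailSq t (ω j) := by
        gcongr
        · exact fun j _ _ => tailSq_nonneg t _
        · exact Finset.subset_univ A
    _ ≤ _ := by rw [← Finset.sum_range (fun i => tailSq t (ω i))]; nlinarith

theorem eventually_gaussianDirection_notMem {ω : ℕ → ℝ} {t ν₀ κ F : ℝ} (ht : 0 ≤ t) (hν₀ : 0 ≤ ν₀)
    (hS : Tendsto (fun n : ℕ => (∑ i ∈ Finset.range n, ω i ^ 2) / n) atTop (𝓝 1))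
    (hT : Tendsto (fun n : ℕ => (∑ i ∈ Finset.range n, tailSq t (ω i)) / n) atTop (𝓝 F))
    (hF : κ ^ 2 < F) (hνt : κ ^ 2 < ν₀ * t) {ν : ℕ → ℝ} (hν : ∀ N, ν₀ ≤ ν N) :
    ∀ᶠ N : ℕ in atTop, gaussianDirection N ω ∉ delocalizedSet N (ν N * N) κ := by
  have hlim₁ := (hS.const_mul (κ ^ 2)).eventually_lt hT (by simpa using hF)
  -- The term `t / N` absorbs the rounding of `ν₀ * N` to an integer below.
  have hlim₂ := (hS.const_mul (κ ^ 2)).eventually_lt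
    ((tendsto_const_div_atTop_nhds_zero_nat t).const_sub (ν₀ * t)) (by simpa using hνt)
  filter_upwards [hlim₁, hlim₂, eventually_gt_atTop 0, eventually_sum_pos hS]
    with N h₁ h₂ hN hpos
  have hN' : (0 : ℝ) < N := by exact_mod_cast hN
  rw [gaussianDirection_mem_delocalizedSet_iff hpos]
  push Not
  set S := ∑ i ∈ Finset.range N, ω i ^ 2
  have h₁' : κ ^ 2 * S < ∑ i ∈ Finset.range N, tailSq t (ω i) := by
    rw [← mul_div_assoc] at h₁
    exact (div_lt_div_iff_of_pos_right hN').1 h₁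
  have h₂' : κ ^ 2 * S < ν₀ * t * N - t := by
    rw [← mul_div_assoc, div_lt_iff₀ hN'] at h₂
    refine h₂.trans_eq ?_
    field_simp
  have hνN : ν₀ * N ≤ ν N * N := by gcongr; exact hν N
  set B : Finset (Fin N) := Finset.univ.filter fun i => t < ω i ^ 2 with hB
  -- Either all large coordinates fit in the budget and carry mass about `F N`, or any `⌊ν₀ * N⌋₊`
  -- of them carry at least `t` each.
  rcases le_or_gt (B.card : ℝ) (ν₀ * N) with hc | hc
  · refine ⟨B, hc.trans hνN, h₁'.trans_eq ?_⟩
    rw [Finset.sum_range (fun i => tailSq t (ω i)), hB, Finset.sum_filter]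
    rfl
  · have hnn : 0 ≤ ν₀ * N := by positivity
    obtain ⟨A, hAB, hA⟩ := Finset.exists_subset_card_eq
      (s := B) (n := ⌊ν₀ * N⌋₊) (Nat.floor_le_of_le hc.le)
    refine ⟨A, ?_, h₂'.trans_le ?_⟩
    · rw [hA]; exact (Nat.floor_le hnn).trans hνN
    · calc ν₀ * t * N - t = (ν₀ * N - 1) * t := by ring
        _ ≤ A.card * t := by
            gcongr; rw [hA]; linarith [Nat.lt_floor_add_one (ν₀ * N)]
        _ = ∑ j ∈ A, t := by simp
        _ ≤ ∑ j ∈ A, ω j ^ 2 := Finset.sum_le_sum fun j hj =>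
            (Finset.mem_filter.1 (hAB hj)).2.le

/-- If at least all coordinates are allowed, no unit vector is delocalized. -/
theorem delocalizedSet_eq_empty {N : ℕ} {L κ : ℝ} (hκ : 0 < κ) (hκ1 : κ < 1) (hL : (N : ℝ) ≤ L) :
    delocalizedSet N L κ = ∅ := by
  refine Set.eq_empty_of_forall_notMem ?_
  rintro v ⟨hv, h⟩
  have h1 := h Finset.univ (by simpa using hL)
  have h2 : ∑ j, |v j| ^ 2 = 1 := by
    have h3 := EuclideanSpace.norm_sq_eq v
    rw [mem_sphere_zero_iff_norm.1 hv, one_pow] at h3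
    exact h3.symm
  rw [h2] at h1
  nlinarith

theorem measureReal_mem_delocalizedSet {N : ℕ} (hN : 1 ≤ N) {Ω : Type*} [MeasurableSpace Ω]
    {P : Measure Ω} {V : Ω → EuclideanSpace ℝ (Fin N)} (hV : HasLaw V (uniformSphere N) P)
    (L κ : ℝ) :
    P.real {ω | V ω ∈ delocalizedSet N L κ} =
      (Measure.infinitePi (fun _ : ℕ => gaussianReal 0 1)).real
        {ω | gaussianDirection N ω ∈ delocalizedSet N L κ} := by
  have hm := measurableSet_delocalizedSet N L κ
  rw [hV.measureReal_eq (p := fun x => x ∈ delocalizedSet N L κ) hm,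
    Set.ofPred_mem_eq, ← map_gaussianDirection hN, map_measureReal_apply (measurable_gaussianDirection N) hm]
  rfl

/-! ### Choice of thresholds and constants. -/

theorem integral_tailSq_le_half_sq {κ : ℝ} (hκ : 0 < κ) (hκ1 : κ < 1) :
    ∫ x, tailSq (32 * Real.log (Real.exp 1 / κ)) x ∂(gaussianReal 0 1) ≤ κ ^ 2 / 2 := by
  refine (integral_tailSq_gaussian_le _).trans ?_
  have he : Real.exp (-(32 * Real.log (Real.exp 1 / κ)) / 8) = κ ^ 4 / Real.exp 1 ^ 4 := by
    rw [show -(32 * Real.log (Real.exp 1 / κ)) / 8 = -((4 : ℕ) * Real.log (Real.exp 1 / κ)) by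
      push_cast; ring, Real.exp_neg, Real.exp_nat_mul, Real.exp_log (by positivity), div_pow,
      inv_div]
  have h32 : (32 : ℝ) ≤ Real.exp 1 ^ 4 := by
    calc (32 : ℝ) ≤ 2.5 ^ 4 := by norm_num
      _ ≤ _ := by gcongr; linarith [Real.exp_one_gt_d9]
  rw [he]
  calc 16 * (κ ^ 4 / Real.exp 1 ^ 4) ≤ 16 * (κ ^ 2 / 32) := by
        gcongr ?_ * ?_
        exact div_le_div₀ (by positivity) (pow_le_pow_of_le_one hκ.le hκ1.le (by norm_num))
          (by norm_num) h32
    _ = κ ^ 2 / 2 := by ring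

theorem one_lt_log_exp_one_div {κ : ℝ} (hκ : 0 < κ) (hκ1 : κ < 1) :
    1 < Real.log (Real.exp 1 / κ) := by
  rw [Real.log_div (Real.exp_pos 1).ne' hκ.ne', Real.log_exp]
  linarith [Real.log_neg hκ hκ1]

theorem sq_lt_integral_tailSq {κ : ℝ} (hκ : 0 < κ) (hκ1 : κ < 1 / 27) :
    κ ^ 2 < ∫ x, tailSq (Real.log (Real.exp 1 / κ)) x ∂(gaussianReal 0 1) := by
  have hl := one_lt_log_exp_one_div hκ (hκ1.trans (by norm_num))
  refine lt_of_lt_of_le ?_ (le_integral_tailSq_gaussian (by linarith))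
  set l := Real.log (Real.exp 1 / κ) with hldef
  have he : Real.exp (-(l + 1)) = κ / Real.exp 1 ^ 2 := by
    rw [Real.exp_neg, Real.exp_add, hldef, Real.exp_log (by positivity)]
    field_simp
  have h9 : Real.exp 1 ^ 2 ≤ 9 := by
    calc Real.exp 1 ^ 2 ≤ 3 ^ 2 := by gcongr; linarith [Real.exp_one_lt_d9]
      _ = 9 := by norm_num
  -- This is where `κ < 1 / 27` is needed.
  calc κ ^ 2 < κ / 9 / 3 := by nlinarith
    _ ≤ Real.exp (-(l + 1)) / 3 := by rw [he]; gcongr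
    _ ≤ l * (Real.exp (-(l + 1)) / 3) := le_mul_of_one_le_left (by positivity) hl.le

theorem mainTheorem2 :
    ∃ c₁ c₂ : ℝ, 0 < c₁ ∧ 0 < c₂ ∧
      ∀ κ : ℝ, 0 < κ → κ < 1 →
      ∀ (Ω : ℕ → Type*) [∀ N, MeasurableSpace (Ω N)]
        (P : ∀ N, Measure (Ω N)) [∀ N, IsProbabilityMeasure (P N)]
        (V : ∀ N, Ω N → EuclideanSpace ℝ (Fin N)),
        (∀ N, 1 ≤ N → HasLaw (V N) (uniformSphere N) (P N)) →
      ∀ ν : ℕ → ℝ,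
        ((∀ N, ν N ≤ c₁ * κ ^ 2 / Real.log (Real.exp 1 / κ)) →
          Tendsto (fun N => (P N).real {ω | V N ω ∈ delocalizedSet N (ν N * N) κ})
            atTop (𝓝 1)) ∧
        ((∀ N, c₂ * κ ^ 2 / Real.log (Real.exp 1 / κ) ≤ ν N) →
          Tendsto (fun N => (P N).real {ω | V N ω ∈ delocalizedSet N (ν N * N) κ})
            atTop (𝓝 0)) := by
  -- With `t = 32 * l`, `1 / 128` makes `ν₀ * t = κ ^ 2 / 4`. The value `60000` exceeds `81 * 27 ^
  -- 2`, as the case `κ ≥ 1 / 27` requires.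
  refine ⟨1 / 128, 60000, by norm_num, by norm_num, fun κ hκ hκ1 Ω _ P _ V hV ν => ?_⟩
  set l := Real.log (Real.exp 1 / κ) with hl
  have hl1 : 1 < l := one_lt_log_exp_one_div hκ hκ1
  have hl0 : 0 < l := by linarith
  set μ := Measure.infinitePi (fun _ : ℕ => gaussianReal 0 1) with hμ
  set E : ℕ → Set (ℕ → ℝ) := fun N =>
    {ω | gaussianDirection N ω ∈ delocalizedSet N (ν N * N) κ} with hE
  have hEm : ∀ N, MeasurableSet (E N) := fun N =>
    measurable_gaussianDirection N (measurableSet_delocalizedSet N _ κ)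
  have htransfer : (fun N => (P N).real {ω | V N ω ∈ delocalizedSet N (ν N * N) κ})
      =ᶠ[atTop] fun N => μ.real (E N) := by
    filter_upwards [eventually_ge_atTop 1] with N hN
    exact measureReal_mem_delocalizedSet hN (hV N hN) _ κ
  -- Dominated convergence of indicators, applied with `A` the whole space or empty.
  have hlimit : ∀ A : Set (ℕ → ℝ), MeasurableSet A →
      (∀ᵐ ω ∂μ, ∀ᶠ N in atTop, ω ∈ E N ↔ ω ∈ A) →
      Tendsto (fun N => (P N).real {ω | V N ω ∈ delocalizedSet N (ν N * N) κ})
        atTop (𝓝 (μ.real A)) := fun A hA h =>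
    ((ENNReal.tendsto_toReal (measure_ne_top μ A)).comp
      (tendsto_measure_of_ae_tendsto_indicator_of_isFiniteMeasure atTop hA hEm h)).congr'
        htransfer.symm
  have hS := ae_tendsto_average_gaussian (f := fun x => x ^ 2) (by fun_prop)
    integrable_sq_gaussian
  rw [integral_sq_gaussian] at hS
  constructor
  · intro hν
    have hT := ae_tendsto_average_gaussian (measurable_tailSq (32 * l))
      (integrable_tailSq_gaussian (32 * l))
    have hF := integral_tailSq_le_half_sq hκ hκ1
    have h := hlimit Set.univ MeasurableSet.univ (by
      filter_upwards [hS, hT] with ω h₁ h₂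
      have := eventually_gaussianDirection_mem (κ := κ) (by positivity) h₁ h₂ (by
        have : 1 / 128 * κ ^ 2 / l * (32 * l) = κ ^ 2 / 4 := by field_simp; norm_num
        rw [this]; linarith [pow_pos hκ 2]) hν
      filter_upwards [this] with N hN
      simpa [hE] using hN)
    simpa using h
  · intro hν
    have hempty : ∀ᵐ ω ∂μ, ∀ᶠ N in atTop, ω ∈ E N ↔ ω ∈ (∅ : Set (ℕ → ℝ)) := by
      rcases lt_or_ge κ (1 / 27) with hk | hk
      · have hT := ae_tendsto_average_gaussian (measurable_tailSq l)
          (integrable_tailSq_gaussian l)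
        filter_upwards [hS, hT] with ω h₁ h₂
        have := eventually_gaussianDirection_notMem (κ := κ) hl0.le (by positivity) h₁ h₂
          (sq_lt_integral_tailSq hκ hk) (by
            rw [div_mul_cancel₀ _ hl0.ne']; linarith [pow_pos hκ 2]) hν
        filter_upwards [this] with N hN
        simpa [hE] using hN
      -- For `κ` bounded below the Gaussian estimate is too weak, but then `ν N ≥ 1` and every
      -- coordinate is allowed.
      · have hl81 : l ≤ 81 := by
          have h1 := Real.log_le_sub_one_of_pos (x := Real.exp 1 / κ) (by positivity)
          have h2 : Real.exp 1 / κ ≤ 3 / (1 / 27) :=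
            div_le_div₀ (by norm_num) (by linarith [Real.exp_one_lt_d9]) (by norm_num) hk
          linarith
        have hone : 1 ≤ 60000 * κ ^ 2 / l := by
          rw [one_le_div hl0]
          nlinarith
        refine Eventually.of_forall fun ω => Eventually.of_forall fun N => ?_
        have hN : (N : ℝ) ≤ ν N * N := le_mul_of_one_le_left (by positivity) (hone.trans (hν N))
        simp [hE, delocalizedSet_eq_empty hκ hκ1 hN]
    simpa using hlimit ∅ MeasurableSet.empty hempty
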